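/- Let $\mathcal A$ be the class of functions $f(z)=z+\sum_{n\ge 2}a_nz^n$ analytic in the open unit disk $\Delta$, and let $\mathcal{SL}^*$ be the class of all $f\in\mathcal A$ such that $zf'(z)/f(z)\prec\sqrt{1+z}$ in $\Delta$ (principal branch). Here, for $F$ and $G$ analytic in $\Delta$, $F\prec G$ means that there is an analytic function $\omega$ on $\Delta$ with $\omega(0)=0$ and $|\omega(z)|<1$ such that $F(z)=G(\omega(z))$ for all $z\in\Delta$; the quotient $zf'(z)/f(z)$ is given its limiting value $1$ at $z=0$. For $f\in\mathcal A$ put $a_1=1$ and $$H_3(1)=\begin{vmatrix}a_1&a_2&a_3\\a_2&a_3&a_4\\a_3&a_4&a_5\end{vmatrix}.$$ Then every $f\in\mathcal{SL}^*$ satisfies $|H_3(1)|\le \tfrac1{36}$. The bound is sharp: the function $$f(z)=z\exp\left(\int_0^z\frac{\sqrt{1+t^3}-1}{t}\,dt\right)$$ belongs to $\mathcal{SL}^*$, has $a_2=a_3=a_5=0$ and $a_4=\tfrac16$, and satisfies $|H_3(1)|=\tfrac1{36}$. -/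

import Mathlib

noncomputable section

namespace LemniscateStarlike

/-- The open unit disk `Δ` of the complex plane. -/
def unitDisk : Set ℂ := Metric.ball (0 : ℂ) 1

/-- The class `𝒜` of analytic functions `f(z) = z + a₂ z² + a₃ z³ + ⋯` on the unit disk.
Only the values of `f` on the disk matter. -/
def ClassA : Set (ℂ → ℂ) :=
  {f | DifferentiableOn ℂ f unitDisk ∧ f 0 = 0 ∧ deriv f 0 = 1}

/-- Schwarz functions: analytic self-maps `ω` of the unit disk with `ω(0) = 0`. -/
def IsSchwarz (w : ℂ → ℂ) : Prop :=
  DifferentiableOn ℂ w unitDisk ∧ w 0 = 0 ∧ ∀ z ∈ unitDisk, ‖w z‖ < 1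

/-- Subordination `F ≺ G` of functions analytic in the unit disk: `F = G ∘ ω` for some Schwarz
function `ω`. -/
def Subordinate (F G : ℂ → ℂ) : Prop :=
  DifferentiableOn ℂ F unitDisk ∧ DifferentiableOn ℂ G unitDisk ∧
    ∃ w : ℂ → ℂ, IsSchwarz w ∧ ∀ z ∈ unitDisk, F z = G (w z)

/-- The function `z f'(z) / f(z)`, with its removable singularity at `0` filled in: for `f` in the
class `𝒜` the limit at `0` is `1`. At another zero of `f` in the disk, Lean's `x / 0 = 0` gives the
value `0`, which `√(1+ω)` does not take for `|ω| < 1`, so that such an `f` is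
not in the class below. -/
def logDerivQuotient (f : ℂ → ℂ) (z : ℂ) : ℂ :=
  if z = 0 then 1 else z * deriv f z / f z

/-- The principal branch of `√(1+z)`, analytic in the unit disk. -/
def sqrtOneAdd (z : ℂ) : ℂ := (1 + z) ^ (1 / 2 : ℂ)

/-- The class `𝒮ℒ*` of all `f` in `𝒜` with `z f'(z) / f(z) ≺ √(1+z)`. -/
def SLstar : Set (ℂ → ℂ) :=
  {f | f ∈ ClassA ∧ Subordinate (logDerivQuotient f) sqrtOneAdd}

/-- The `n`-th Taylor coefficient `aₙ` of `f` at `0`. -/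
def taylorCoeff (f : ℂ → ℂ) (n : ℕ) : ℂ :=
  iteratedDeriv n f 0 / (n.factorial : ℂ)

/-- The Hankel determinant `H_q(n)` of `f`: the `q × q` determinant whose entry in row `i` and
column `j`, counted from `0`, is `a_{n+i+j}`. -/
def hankelDet (f : ℂ → ℂ) (q n : ℕ) : ℂ :=
  Matrix.det (Matrix.of fun i j : Fin q => taylorCoeff f (n + (i : ℕ) + (j : ℕ)))

/-- The integral `∫₀^z g(t) dt` along the segment from `0` to `z`, parametrized by `t = s z`. -/
def segmentIntegral (g : ℂ → ℂ) (z : ℂ) : ℂ :=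
  ∫ s in (0 : ℝ)..1, g ((s : ℂ) * z) * z

/-- The function `z exp (∫₀^z (√(1+t³) - 1) / t dt)`. The integrand has a removable singularity at
`t = 0`, with value `0` there, which is also the value of the Lean expression. -/
def extremalFun (z : ℂ) : ℂ :=
  z * Complex.exp (segmentIntegral (fun t => (sqrtOneAdd (t ^ 3) - 1) / t) z)

end LemniscateStarlike

end

namespace LemniscateStarlike

/-! ### Square-summability of Taylor coefficients. -/

section Bessel

open Real

/-! Write `z f' / f = √(1 + w)` with `w` a Schwarz function. Comparing Taylor coefficients turns
`36864 * H₃(1)` into a polynomial in the first four coefficients of `w` (`hankelDet_eq`). The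
triangle inequality, which discards all phases, then suffices. The only fact needed about these
coefficients is that their squared moduli sum to at most 1 (`sum_sq_norm_taylorCoeff_le`).

What remains is a real inequality on the unit ball of `ℝ⁴` (`coeff_ineq`), where the bound `1024 =
36864 / 36` is attained when only the third coefficient survives. It is reduced to the nonnegativity
of a ternary quartic form. Sharpness comes from `w = z ^ 3`. -/

theorem taylorCoeff_eq_circleIntegral {f : ℂ → ℂ} {r : ℝ} (hr : 0 < r)
    (hf : DifferentiableOn ℂ f (Metric.closedBall 0 r)) (n : ℕ) :
    taylorCoeff f n = (2 * π * Complex.I)⁻¹ • ∮ z in C(0, r), (1 / z) ^ n • z⁻¹ • f z := by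
  lift r to NNReal using hr.le
  have h := hf.hasFPowerSeriesOnBall (by exact_mod_cast hr)
  have h1 := h.factorial_smul (1 : ℂ) n
  rw [cauchyPowerSeries_apply] at h1
  simp only [sub_zero] at h1
  rw [taylorCoeff, iteratedDeriv_eq_iteratedFDeriv, ← h1, nsmul_eq_mul, mul_div_cancel_left₀]
  exact_mod_cast n.factorial_ne_zero

theorem fourierCoeffOn_circleMap {f : ℂ → ℂ} {r : ℝ} (hr : 0 < r)
    (hf : DifferentiableOn ℂ f (Metric.closedBall 0 r)) (n : ℕ) :
    fourierCoeffOn two_pi_pos (fun θ => f (circleMap 0 r θ)) n = r ^ n * taylorCoeff f n := by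
  have hr0 : (r : ℂ) ≠ 0 := by exact_mod_cast hr.ne'
  rw [fourierCoeffOn_eq_integral, taylorCoeff_eq_circleIntegral hr hf, circleIntegral]
  rw [Complex.real_smul, smul_eq_mul, mul_left_comm,
    ← intervalIntegral.integral_const_mul ((r : ℂ) ^ n)]
  have : ∀ θ : ℝ, (r : ℂ) ^ n * (deriv (circleMap 0 r) θ •
      (1 / circleMap 0 r θ) ^ n • (circleMap 0 r θ)⁻¹ • f (circleMap 0 r θ))
      = Complex.I * (fourier (-(n : ℤ)) (θ : AddCircle (2 * π - 0)) • f (circleMap 0 r θ)) := by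
    intro θ
    have hE : Complex.exp (θ * Complex.I) ≠ 0 := Complex.exp_ne_zero _
    have hF : fourier (-(n : ℤ)) (θ : AddCircle (2 * π - 0)) = (Complex.exp (θ * Complex.I) ^ n)⁻¹ := by
      rw [fourier_coe_apply, ← Complex.exp_nat_mul, ← Complex.exp_neg]
      congr 1
      have : (π : ℂ) ≠ 0 := by exact_mod_cast pi_ne_zero
      push_cast
      field_simp
      simp [mul_comm, mul_assoc, mul_left_comm]
    rw [hF, deriv_circleMap]
    simp only [circleMap_zero, smul_eq_mul, one_div, mul_inv, inv_pow, mul_pow]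
    field_simp
  simp_rw [this]
  rw [intervalIntegral.integral_const_mul]
  have : (π : ℂ) ≠ 0 := by exact_mod_cast pi_ne_zero
  push_cast
  field_simp
  simp

/-- **Bessel's inequality** for the Taylor coefficients of a bounded analytic function. -/
theorem sum_sq_norm_taylorCoeff_le {f : ℂ → ℂ} (hf : DifferentiableOn ℂ f unitDisk)
    (hb : ∀ z ∈ unitDisk, ‖f z‖ ≤ 1) (s : Finset ℕ) :
    ∑ n ∈ s, ‖taylorCoeff f n‖ ^ 2 ≤ 1 := by
  -- Parseval on the circle of radius `r < 1`, keeping only the frequencies in `s`; then `r → 1`.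
  have main : ∀ r ∈ Set.Ioo (0 : ℝ) 1, ∑ n ∈ s, (r ^ n * ‖taylorCoeff f n‖) ^ 2 ≤ 1 := by
    rintro r ⟨hr0, hr1⟩
    have hsub : Metric.closedBall (0 : ℂ) r ⊆ unitDisk := Metric.closedBall_subset_ball hr1
    have hmem : ∀ θ, circleMap 0 r θ ∈ Metric.closedBall (0 : ℂ) r := fun θ =>
      Metric.sphere_subset_closedBall (circleMap_mem_sphere 0 hr0.le θ)
    have hcont : Continuous fun θ : ℝ => f (circleMap 0 r θ) :=
      (hf.mono hsub).continuousOn.comp_continuous (continuous_circleMap 0 r) hmem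
    have hle : ∀ θ, ‖f (circleMap 0 r θ)‖ ≤ 1 := fun θ => hb _ (hsub (hmem θ))
    have hL2 : MeasureTheory.MemLp (fun θ : ℝ => f (circleMap 0 r θ)) 2
        (MeasureTheory.volume.restrict (Set.Ioc 0 (2 * π))) :=
      MeasureTheory.MemLp.of_bound hcont.aestronglyMeasurable 1 (Filter.Eventually.of_forall hle)
    have hsum := hasSum_sq_fourierCoeffOn two_pi_pos hL2
    have h1 := sum_le_hasSum (s.map Nat.castEmbedding) (fun _ _ => by positivity) hsum
    rw [Finset.sum_map] at h1
    simp only [Nat.castEmbedding_apply, fourierCoeffOn_circleMap hr0 (hf.mono hsub), norm_mul,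
      norm_pow, Complex.norm_real, Real.norm_of_nonneg hr0.le, sub_zero, smul_eq_mul] at h1
    refine h1.trans ?_
    have h2 : ∫ θ in (0 : ℝ)..2 * π, ‖f (circleMap 0 r θ)‖ ^ 2 ≤ ∫ θ in (0 : ℝ)..2 * π, (1 : ℝ) := by
      refine intervalIntegral.integral_mono_on two_pi_pos.le
        ((hcont.norm.pow 2).intervalIntegrable _ _) (by simp) fun θ _ => ?_
      exact pow_le_one₀ (norm_nonneg _) (hle θ)
    simp only [intervalIntegral.integral_const, sub_zero, smul_eq_mul, mul_one] at h2
    rw [inv_mul_le_iff₀ two_pi_pos, mul_one]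
    exact h2
  have hlim : Filter.Tendsto (fun r : ℝ => ∑ n ∈ s, (r ^ n * ‖taylorCoeff f n‖) ^ 2)
      (nhdsWithin 1 (Set.Iio 1)) (nhds (∑ n ∈ s, ‖taylorCoeff f n‖ ^ 2)) := by
    have : Continuous fun r : ℝ => ∑ n ∈ s, (r ^ n * ‖taylorCoeff f n‖) ^ 2 := by fun_prop
    simpa [ContinuousWithinAt] using this.continuousWithinAt (s := Set.Iio 1) (x := 1)
  refine le_of_tendsto hlim ?_
  filter_upwards [Ioo_mem_nhdsLT (zero_lt_one' ℝ)] with r hr using main r hr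

end Bessel

/-! ### Taylor expansion as a map to formal power series. -/

section TaylorSeries

open PowerSeries

/-- The Taylor series of `f` at `0`, as a formal power series. -/
noncomputable def taylorSeries (f : ℂ → ℂ) : ℂ⟦X⟧ := PowerSeries.mk (taylorCoeff f)

theorem coeff_taylorSeries (f : ℂ → ℂ) (n : ℕ) : coeff n (taylorSeries f) = taylorCoeff f n :=
  coeff_mk _ _

theorem taylorCoeff_zero (f : ℂ → ℂ) : taylorCoeff f 0 = f 0 := by simp [taylorCoeff]

theorem taylorCoeff_one (f : ℂ → ℂ) : taylorCoeff f 1 = deriv f 0 := by simp [taylorCoeff]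

theorem taylorSeries_congr {f g : ℂ → ℂ} (h : f =ᶠ[nhds 0] g) :
    taylorSeries f = taylorSeries g := by
  ext n
  rw [coeff_taylorSeries, coeff_taylorSeries, taylorCoeff, taylorCoeff, h.iteratedDeriv_eq]

theorem taylorSeries_mul {f g : ℂ → ℂ} (hf : AnalyticAt ℂ f 0) (hg : AnalyticAt ℂ g 0) :
    taylorSeries (f * g) = taylorSeries f * taylorSeries g := by
  ext n
  simp only [coeff_taylorSeries, taylorCoeff, iteratedDeriv_mul hf.contDiffAt hg.contDiffAt,
    PowerSeries.coeff_mul, Finset.Nat.sum_antidiagonal_eq_sum_range_succ_mk, Nat.succ_eq_add_one,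
    Finset.sum_div]
  refine Finset.sum_congr rfl fun i hi ↦ ?_
  rw [Nat.cast_choose _ (by grind)]
  field_simp [Nat.factorial_ne_zero]

theorem taylorSeries_one_add {f : ℂ → ℂ} (hf : AnalyticAt ℂ f 0) :
    taylorSeries (fun z => 1 + f z) = 1 + taylorSeries f := by
  ext n
  rw [map_add, coeff_taylorSeries, coeff_taylorSeries, coeff_one, taylorCoeff, taylorCoeff,
    iteratedDeriv_fun_add contDiffAt_const hf.contDiffAt, iteratedDeriv_const]
  split_ifs with h
  · simp [h]
  · simp

theorem taylorCoeff_pow (m n : ℕ) :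
    taylorCoeff (fun z => z ^ m) n = if n = m then 1 else 0 := by
  rw [taylorCoeff, iteratedDeriv_fun_pow_zero]
  split_ifs with h
  · rw [h, div_self (by exact_mod_cast m.factorial_ne_zero)]
  · simp

theorem taylorSeries_id : taylorSeries (fun z => z) = X := by
  ext n
  rw [coeff_taylorSeries, coeff_X]
  simpa using taylorCoeff_pow 1 n

theorem taylorCoeff_deriv (f : ℂ → ℂ) (n : ℕ) :
    taylorCoeff (deriv f) n = (n + 1) * taylorCoeff f (n + 1) := by
  rw [taylorCoeff, taylorCoeff, iteratedDeriv_succ', Nat.factorial_succ]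
  have : (n.factorial : ℂ) ≠ 0 := by exact_mod_cast n.factorial_ne_zero
  have h2 : (n : ℂ) + 1 ≠ 0 := by exact_mod_cast n.succ_ne_zero
  push_cast
  field_simp

end TaylorSeries

/-! ### The real inequality on the unit ball. -/

section Inequality

/-- This is 29 times the negated discriminant `4AC - B²` in `quartic_form_nonneg`. The form is
smallest near `a / e = 7 / 8`, so monomial multiples of `(a - 7 / 8 * e) ^ 2` certify it. -/
theorem sextic_form_nonneg {a e : ℝ} (ha : 0 ≤ a) (he : 0 ≤ e) :
    0 ≤ 112596952 * 29 * a ^ 6 - 87989760 * 29 * (a ^ 5 * e) + 98168960 * (a ^ 4 * e ^ 2)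
      - 1190707200 * (a ^ 3 * e ^ 3) + 1768558592 * (a ^ 2 * e ^ 4)
      - 3053813760 * (a * e ^ 5) + 1952235520 * e ^ 6 := by
  have hs := sq_nonneg (a - 7 / 8 * e)
  have h0 : 0 ≤ a ^ 6 := by positivity
  have h1 : 0 ≤ a ^ 5 * e := by positivity
  have h2 : 0 ≤ a ^ 4 * e ^ 2 := by positivity
  have h3 : 0 ≤ a ^ 3 * e ^ 3 := by positivity
  have h4 : 0 ≤ a ^ 2 * e ^ 4 := by positivity
  have h5 : 0 ≤ a * e ^ 5 := by positivity
  have h6 : 0 ≤ e ^ 6 := by positivity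
  have k0 := mul_nonneg (show 0 ≤ a ^ 4 by positivity) hs
  have k1 := mul_nonneg (show 0 ≤ a ^ 3 * e by positivity) hs
  have k2 := mul_nonneg (show 0 ≤ a ^ 2 * e ^ 2 by positivity) hs
  have k3 := mul_nonneg (show 0 ≤ a * e ^ 3 by positivity) hs
  have k4 := mul_nonneg (show 0 ≤ e ^ 4 by positivity) hs
  linarith

/-- As a quartic in `b`, the form is a square absorbing the `b ^ 4` and `b ^ 3` terms plus a
quadratic `A b² - B b + C` with nonpositive discriminant. -/
theorem quartic_form_nonneg {a b e : ℝ} (ha : 0 ≤ a) (he : 0 ≤ e) :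
    0 ≤ 3973 * a ^ 4 + 1856 * b ^ 4 + 5120 * e ^ 4
        + 8254 * (a ^ 2 * b ^ 2) - 992 * (a ^ 2 * e ^ 2) + 9376 * (b ^ 2 * e ^ 2)
        - 5760 * (b * e * (a ^ 2 + b ^ 2 + e ^ 2))
        - 2432 * (a * b * (a ^ 2 + b ^ 2 + e ^ 2)) := by
  have hD := sextic_form_nonneg ha he
  obtain ⟨A, hA⟩ : ∃ A, A = 8254 * a ^ 2 + 9376 * e ^ 2 - 64 / 29 * (45 * e + 19 * a) ^ 2 := ⟨_, rfl⟩
  obtain ⟨B, hB⟩ : ∃ B, B = (a ^ 2 + e ^ 2) * (5760 * e + 2432 * a) := ⟨_, rfl⟩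
  obtain ⟨C, hC⟩ : ∃ C, C = 3973 * a ^ 4 - 992 * (a ^ 2 * e ^ 2) + 5120 * e ^ 4 := ⟨_, rfl⟩
  have hdisc : 0 ≤ 4 * A * C - B ^ 2 := by
    rw [hA, hB, hC]
    linarith
  -- Scaled by `64 / 29`, this matches `1856 b⁴ - (5760 e + 2432 a) b³`.
  have hsq := mul_nonneg (sq_nonneg b) (sq_nonneg (29 * b - (45 * e + 19 * a)))
  have hA0 : 0 ≤ A := by
    rw [hA]
    nlinarith [sq_nonneg (a - e), sq_nonneg a, sq_nonneg e]
  have hpos : 0 ≤ A * b ^ 2 - B * b + C := by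
    rcases hA0.eq_or_lt with h0 | h0
    · have hB0 : B = 0 := by
        rw [← h0] at hdisc
        nlinarith [sq_nonneg B]
      rw [← h0, hB0, hC]
      nlinarith [sq_nonneg (a ^ 2 - e ^ 2), sq_nonneg (a ^ 2), sq_nonneg (e ^ 2)]
    · have : 0 ≤ 4 * A * (A * b ^ 2 - B * b + C) := by
        linarith [sq_nonneg (2 * A * b - B)]
      exact nonneg_of_mul_nonneg_right this (by linarith)
  rw [hA, hB, hC] at hpos
  linarith

/-- On the unit ball of `ℝ⁴`, the sum of the moduli of the terms of the Hankel determinant is at most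
its value at the extremal point `d = 1`. -/
theorem coeff_ineq {a b d e : ℝ} (ha : 0 ≤ a) (hb : 0 ≤ b) (he : 0 ≤ e)
    (h : a ^ 2 + b ^ 2 + d ^ 2 + e ^ 2 ≤ 1) :
    1024 * d ^ 2 + 1152 * (b * e) + 576 * b ^ 3 + 1216 * (a * b * d) + 864 * (a ^ 2 * e)
      + 80 * (a ^ 2 * b ^ 2) + 112 * (a ^ 3 * d) + 116 * (a ^ 4 * b) + 29 * a ^ 6 ≤ 1024 := by
  have hab := mul_nonneg ha hb
  obtain ⟨p, hp⟩ : ∃ p, p = a ^ 2 + b ^ 2 + e ^ 2 := ⟨_, rfl⟩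
  have hp1 : p ≤ 1 := by linarith [sq_nonneg d]
  have ha1 : a ^ 2 ≤ 1 := by linarith [sq_nonneg d, sq_nonneg b, sq_nonneg e]
  -- Together with `d ^ 2 ≤ 1 - p`, the bounds `hd1` to `h6` eliminate `d` and leave only terms of
  -- degree 2 and 4 in `a, b, e`.
  have hd1 : d ≤ 41 / 40 - 5 / 8 * p := by linarith [sq_nonneg (d - 4 / 5)]
  have h1 : a * b * d ≤ 41 / 40 * (a * b) - 5 / 8 * (a * b * p) := by
    linarith [mul_le_mul_of_nonneg_left hd1 hab]
  have h2 : 576 * b ^ 3 ≤ 864 / 5 * b ^ 2 + 480 * b ^ 4 := by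
    linarith [mul_nonneg (sq_nonneg b) (sq_nonneg (b - 3 / 5))]
  have h3 : a ^ 2 * e ≤ 1 / 10 * a ^ 2 + 5 / 2 * (a ^ 2 * e ^ 2) := by
    linarith [mul_nonneg (sq_nonneg a) (sq_nonneg (e - 1 / 5))]
  have h4 : 112 * (a ^ 3 * d) ≤ 56 * a ^ 2 - 56 * (a ^ 2 * (b ^ 2 + e ^ 2)) := by
    linarith [mul_nonneg (sq_nonneg a) (sq_nonneg (a - d)),
      mul_nonneg (sq_nonneg a) (sub_nonneg.2 h)]
  have h5 : a ^ 4 * b ≤ (a ^ 4 + a ^ 2 * b ^ 2) / 2 := by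
    linarith [mul_nonneg (sq_nonneg (a ^ 2)) (sq_nonneg (b - 1)),
      mul_nonneg (mul_nonneg (sq_nonneg a) (sq_nonneg b)) (sub_nonneg.2 ha1)]
  have h6 : a ^ 6 ≤ a ^ 4 := by
    linarith [mul_nonneg (sq_nonneg (a ^ 2)) (sub_nonneg.2 ha1)]
  -- `q` collects the quadratic terms. Since `q ≥ 0` and `p ≤ 1`, replacing `q` by `p * q` only
  -- loses and makes everything homogeneous of degree 4: one fifth of the form in
  -- `quartic_form_nonneg`.
  obtain ⟨q, hq⟩ : ∃ q, q = 1024 * p - 1152 * (b * e) - 6232 / 5 * (a * b) - 864 / 5 * b ^ 2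
      - 712 / 5 * a ^ 2 := ⟨_, rfl⟩
  have hq0 : 0 ≤ q := by
    rw [hq, hp]
    linarith [sq_nonneg (e - 9 / 16 * b), sq_nonneg (a - 3 / 4 * b), sq_nonneg b, sq_nonneg a]
  have hq4 : 0 ≤ p * q + (760 * (a * b * p) - 480 * b ^ 4 - 2160 * (a ^ 2 * e ^ 2)
      - 138 * (a ^ 2 * b ^ 2) - 87 * a ^ 4 + 56 * (a ^ 2 * (b ^ 2 + e ^ 2))) := by
    rw [hq, hp]
    linarith [quartic_form_nonneg (b := b) ha he]
  linarith [mul_nonneg (sub_nonneg.2 hp1) hq0]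

end Inequality

/-! ### The Hankel determinant in terms of the Schwarz function. -/

section Bound

open PowerSeries

theorem sqrtOneAdd_sq (z : ℂ) : sqrtOneAdd z * sqrtOneAdd z = 1 + z := by
  rw [sqrtOneAdd, ← pow_two, one_div]
  exact Complex.cpow_nat_inv_pow (1 + z) two_ne_zero

theorem differentiableOn_sqrtOneAdd : DifferentiableOn ℂ sqrtOneAdd unitDisk := by
  intro z hz
  have hz : ‖z‖ < 1 := by simpa [unitDisk] using hz
  have hmem : 1 + z ∈ Complex.slitPlane := Complex.mem_slitPlane_of_norm_lt_one hz
  exact DifferentiableAt.differentiableWithinAt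
    (((differentiableAt_const _).add differentiableAt_id).cpow (differentiableAt_const _) hmem)

theorem sqrtOneAdd_zero : sqrtOneAdd 0 = 1 := by simp [sqrtOneAdd]

theorem isOpen_unitDisk : IsOpen unitDisk := Metric.isOpen_ball

theorem zero_mem_unitDisk : (0 : ℂ) ∈ unitDisk := Metric.mem_ball_self one_pos

theorem unitDisk_mem_nhds : unitDisk ∈ nhds (0 : ℂ) := isOpen_unitDisk.mem_nhds zero_mem_unitDisk

theorem IsSchwarz.mapsTo {w : ℂ → ℂ} (hw : IsSchwarz w) : Set.MapsTo w unitDisk unitDisk :=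
  fun z hz => mem_ball_zero_iff.2 (hw.2.2 z hz)

theorem mul_deriv_eq {f w : ℂ → ℂ} (hf : f ∈ ClassA) (hw : IsSchwarz w)
    (h : ∀ z ∈ unitDisk, logDerivQuotient f z = sqrtOneAdd (w z)) {z : ℂ} (hz : z ∈ unitDisk) :
    z * deriv f z = sqrtOneAdd (w z) * f z := by
  by_cases h0 : z = 0
  · simp [h0, hf.2.1]
  have h1 := h z hz
  rw [logDerivQuotient, if_neg h0] at h1
  -- At a zero of `f`, division by zero would give `√(1 + w z) = 0`, so `w z = -1`, outside the
  -- disk.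
  have hne : f z ≠ 0 := by
    intro hfz
    rw [hfz, div_zero] at h1
    have h2 := sqrtOneAdd_sq (w z)
    rw [← h1, mul_zero] at h2
    have h3 := hw.2.2 z hz
    rw [show w z = -1 by linear_combination -h2, norm_neg, norm_one] at h3
    exact lt_irrefl _ h3
  rw [← h1, div_mul_cancel₀ _ hne]

/-- With `s = √(1 + w)`, the identities `s * s = 1 + w` and `z f' = s f` determine the coefficients
recursively, so the binomial series is not needed. -/
theorem taylorCoeff_of_logDerivQuotient_eq {f w : ℂ → ℂ} (hf : f ∈ ClassA) (hw : IsSchwarz w)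
    (h : ∀ z ∈ unitDisk, logDerivQuotient f z = sqrtOneAdd (w z)) :
    taylorCoeff f 2 = taylorCoeff w 1 / 2 ∧
    taylorCoeff f 3 = taylorCoeff w 2 / 4 + taylorCoeff w 1 ^ 2 / 16 ∧
    taylorCoeff f 4 = taylorCoeff w 3 / 6 + taylorCoeff w 1 * taylorCoeff w 2 / 24
      + taylorCoeff w 1 ^ 3 / 96 ∧
    taylorCoeff f 5 = taylorCoeff w 4 / 8 + taylorCoeff w 1 * taylorCoeff w 3 / 48
      + taylorCoeff w 1 ^ 2 * taylorCoeff w 2 / 48 - taylorCoeff w 1 ^ 4 / 384 := by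
  have hfa : AnalyticAt ℂ f 0 := hf.1.analyticAt unitDisk_mem_nhds
  have hwa : AnalyticAt ℂ w 0 := hw.1.analyticAt unitDisk_mem_nhds
  obtain ⟨s, hs⟩ : ∃ s : ℂ → ℂ, s = fun z => sqrtOneAdd (w z) := ⟨_, rfl⟩
  have hsa : AnalyticAt ℂ s 0 := by
    rw [hs]
    exact (differentiableOn_sqrtOneAdd.comp hw.1 hw.mapsTo).analyticAt unitDisk_mem_nhds
  have e1 : taylorSeries s * taylorSeries s = 1 + taylorSeries w := by
    rw [← taylorSeries_mul hsa hsa, ← taylorSeries_one_add hwa]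
    congr 1
    funext z
    simp only [hs, Pi.mul_apply, sqrtOneAdd_sq]
  have e2 : X * taylorSeries (deriv f) = taylorSeries s * taylorSeries f := by
    rw [← taylorSeries_mul hsa hfa, ← taylorSeries_id,
      ← taylorSeries_mul (f := fun z => z) analyticAt_id hfa.deriv]
    refine taylorSeries_congr ?_
    filter_upwards [unitDisk_mem_nhds] with z hz
    simpa [hs] using mul_deriv_eq hf hw h hz
  have s0 : taylorCoeff s 0 = 1 := by simp [taylorCoeff_zero, hs, hw.2.1, sqrtOneAdd_zero]
  have f0 : taylorCoeff f 0 = 0 := by rw [taylorCoeff_zero, hf.2.1]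
  have f1 : taylorCoeff f 1 = 1 := by rw [taylorCoeff_one, hf.2.2]
  have c1 := congrArg (coeff 1) e1
  have c2 := congrArg (coeff 2) e1
  have c3 := congrArg (coeff 3) e1
  have c4 := congrArg (coeff 4) e1
  have d2 := congrArg (coeff (1 + 1)) e2
  have d3 := congrArg (coeff (2 + 1)) e2
  have d4 := congrArg (coeff (3 + 1)) e2
  have d5 := congrArg (coeff (4 + 1)) e2
  rw [coeff_succ_X_mul, coeff_taylorSeries, taylorCoeff_deriv] at d2 d3 d4 d5
  simp [PowerSeries.coeff_mul, Finset.Nat.antidiagonal_succ, coeff_taylorSeries, s0, coeff_one]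
    at c1 c2 c3 c4
  simp [PowerSeries.coeff_mul, Finset.Nat.antidiagonal_succ, coeff_taylorSeries, s0, f0, f1]
    at d2 d3 d4 d5
  have t1 : taylorCoeff s 1 = taylorCoeff w 1 / 2 := by linear_combination c1 / 2
  rw [t1] at c2 c3 c4 d2 d3 d4 d5
  have t2 : taylorCoeff s 2 = taylorCoeff w 2 / 2 - taylorCoeff w 1 ^ 2 / 8 := by
    linear_combination c2 / 2
  rw [t2] at c3 c4 d3 d4 d5
  have t3 : taylorCoeff s 3 = taylorCoeff w 3 / 2 - taylorCoeff w 1 * taylorCoeff w 2 / 4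
      + taylorCoeff w 1 ^ 3 / 16 := by
    linear_combination c3 / 2
  rw [t3] at c4 d4 d5
  have a2 : taylorCoeff f 2 = taylorCoeff w 1 / 2 := by linear_combination d2
  rw [a2] at d3 d4 d5
  have a3 : taylorCoeff f 3 = taylorCoeff w 2 / 4 + taylorCoeff w 1 ^ 2 / 16 := by
    linear_combination d3 / 2
  rw [a3] at d4 d5
  have a4 : taylorCoeff f 4 = taylorCoeff w 3 / 6 + taylorCoeff w 1 * taylorCoeff w 2 / 24
      + taylorCoeff w 1 ^ 3 / 96 := by
    linear_combination d4 / 3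
  rw [a4] at d5
  exact ⟨a2, a3, a4, by linear_combination d5 / 4 + c4 / 8⟩

theorem hankelDet_eq {f w : ℂ → ℂ} (hf : f ∈ ClassA) (hw : IsSchwarz w)
    (h : ∀ z ∈ unitDisk, logDerivQuotient f z = sqrtOneAdd (w z)) :
    36864 * hankelDet f 3 1 = -(1024 * taylorCoeff w 3 ^ 2)
      + 1152 * (taylorCoeff w 2 * taylorCoeff w 4) - 576 * taylorCoeff w 2 ^ 3
      + 1216 * (taylorCoeff w 1 * taylorCoeff w 2 * taylorCoeff w 3)
      - 864 * (taylorCoeff w 1 ^ 2 * taylorCoeff w 4)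
      + 80 * (taylorCoeff w 1 ^ 2 * taylorCoeff w 2 ^ 2)
      + 112 * (taylorCoeff w 1 ^ 3 * taylorCoeff w 3)
      - 116 * (taylorCoeff w 1 ^ 4 * taylorCoeff w 2) + 29 * taylorCoeff w 1 ^ 6 := by
  obtain ⟨h2, h3, h4, h5⟩ := taylorCoeff_of_logDerivQuotient_eq hf hw h
  have h1 : taylorCoeff f 1 = 1 := by rw [taylorCoeff_one, hf.2.2]
  rw [hankelDet, Matrix.det_fin_three]
  simp [h1, h2, h3, h4, h5]
  ring

theorem norm_alternating_sum_le {E : Type*} [SeminormedAddCommGroup E]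
    (x₁ x₂ x₃ x₄ x₅ x₆ x₇ x₈ x₉ : E) :
    ‖-x₁ + x₂ - x₃ + x₄ - x₅ + x₆ + x₇ - x₈ + x₉‖
      ≤ ‖x₁‖ + ‖x₂‖ + ‖x₃‖ + ‖x₄‖ + ‖x₅‖ + ‖x₆‖ + ‖x₇‖ + ‖x₈‖ + ‖x₉‖ := by
  refine (norm_add_le _ _).trans (add_le_add_left ?_ _)
  refine (norm_sub_le _ _).trans (add_le_add_left ?_ _)
  refine (norm_add_le _ _).trans (add_le_add_left ?_ _)
  refine (norm_add_le _ _).trans (add_le_add_left ?_ _)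
  refine (norm_sub_le _ _).trans (add_le_add_left ?_ _)
  refine (norm_add_le _ _).trans (add_le_add_left ?_ _)
  refine (norm_sub_le _ _).trans (add_le_add_left ?_ _)
  refine (norm_add_le _ _).trans (add_le_add_left ?_ _)
  exact (norm_neg x₁).le

theorem norm_hankelDet_le {f : ℂ → ℂ} (hf : f ∈ SLstar) : ‖hankelDet f 3 1‖ ≤ 1 / 36 := by
  obtain ⟨hfA, -, -, w, hw, h⟩ := hf
  have hH := hankelDet_eq hfA hw h
  have hB := sum_sq_norm_taylorCoeff_le hw.1 (fun z hz => (hw.2.2 z hz).le) (Finset.Icc 1 4)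
  simp only [show Finset.Icc 1 4 = {1, 2, 3, 4} by decide] at hB
  simp at hB
  have hN := congrArg norm hH
  generalize taylorCoeff w 1 = a at *
  generalize taylorCoeff w 2 = b at *
  generalize taylorCoeff w 3 = d at *
  generalize taylorCoeff w 4 = e at *
  have hI := coeff_ineq (norm_nonneg a) (norm_nonneg b) (d := ‖d‖) (norm_nonneg e) (by linarith)
  have hT : 36864 * ‖hankelDet f 3 1‖ ≤ 1024 * ‖d‖ ^ 2 + 1152 * (‖b‖ * ‖e‖) + 576 * ‖b‖ ^ 3
      + 1216 * (‖a‖ * ‖b‖ * ‖d‖) + 864 * (‖a‖ ^ 2 * ‖e‖) + 80 * (‖a‖ ^ 2 * ‖b‖ ^ 2)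
      + 112 * (‖a‖ ^ 3 * ‖d‖) + 116 * (‖a‖ ^ 4 * ‖b‖) + 29 * ‖a‖ ^ 6 := by
    rw [norm_mul, Complex.norm_ofNat] at hN
    rw [hN]
    have hS := norm_alternating_sum_le (1024 * d ^ 2) (1152 * (b * e)) (576 * b ^ 3)
      (1216 * (a * b * d)) (864 * (a ^ 2 * e)) (80 * (a ^ 2 * b ^ 2)) (112 * (a ^ 3 * d))
      (116 * (a ^ 4 * b)) (29 * a ^ 6)
    simpa only [norm_mul, norm_pow, Complex.norm_ofNat] using hS
  linarith

end Bound

/-! ### The extremal function. -/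

section Extremal

theorem segmentIntegral_eq {g F : ℂ → ℂ} (hg : ContinuousOn g unitDisk)
    (hF : ∀ z ∈ unitDisk, HasDerivAt F (g z) z) (hF0 : F 0 = 0) {z : ℂ} (hz : z ∈ unitDisk) :
    segmentIntegral g z = F z := by
  have hmem : ∀ s ∈ Set.uIcc (0 : ℝ) 1, (s : ℂ) * z ∈ unitDisk := by
    intro s hs
    rw [Set.uIcc_of_le zero_le_one] at hs
    have hz' : ‖z‖ < 1 := by simpa [unitDisk] using hz
    rw [unitDisk, mem_ball_zero_iff, norm_mul, Complex.norm_real, Real.norm_of_nonneg hs.1]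
    exact (mul_le_of_le_one_left (norm_nonneg z) hs.2).trans_lt hz'
  have hd : ∀ s ∈ Set.uIcc (0 : ℝ) 1,
      HasDerivAt (fun s : ℝ => F ((s : ℂ) * z)) (g ((s : ℂ) * z) * z) s := by
    intro s hs
    have h1 : HasDerivAt (fun s : ℝ => (s : ℂ) * z) (1 * z) s :=
      (Complex.ofRealCLM.hasDerivAt (x := s)).mul_const z
    rw [one_mul] at h1
    exact (hF _ (hmem s hs)).comp s h1
  have hc : ContinuousOn (fun s : ℝ => g ((s : ℂ) * z) * z) (Set.uIcc 0 1) :=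
    (hg.comp (by fun_prop) hmem).mul continuousOn_const
  rw [segmentIntegral, intervalIntegral.integral_eq_sub_of_hasDerivAt hd hc.intervalIntegrable]
  simp [hF0]

theorem isSchwarz_cube : IsSchwarz fun z => z ^ 3 := by
  refine ⟨by fun_prop, by simp, fun z hz => ?_⟩
  rw [norm_pow]
  exact pow_lt_one₀ (norm_nonneg z) (by simpa [unitDisk] using hz) three_ne_zero

theorem differentiableOn_sqrtOneAdd_cube :
    DifferentiableOn ℂ (fun z => sqrtOneAdd (z ^ 3)) unitDisk :=
  differentiableOn_sqrtOneAdd.comp isSchwarz_cube.1 isSchwarz_cube.mapsTo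

theorem hasDerivAt_sqrtOneAdd_cube_zero : HasDerivAt (fun z => sqrtOneAdd (z ^ 3) - 1) 0 0 := by
  have h1 : HasDerivAt sqrtOneAdd (deriv sqrtOneAdd 0) ((fun z : ℂ => z ^ 3) 0) := by
    simpa using (differentiableOn_sqrtOneAdd.differentiableAt unitDisk_mem_nhds).hasDerivAt
  have h2 : HasDerivAt (fun z : ℂ => z ^ 3) 0 0 := by simpa using hasDerivAt_pow 3 (0 : ℂ)
  simpa using (h1.comp 0 h2).sub_const 1

/-- The integrand is the slope at 0 of `√(1 + t³) - 1`, whose derivative there is 0; this agrees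
with the value of division by zero. -/
theorem differentiableOn_extremal_integrand :
    DifferentiableOn ℂ (fun t => (sqrtOneAdd (t ^ 3) - 1) / t) unitDisk := by
  have h := (Complex.differentiableOn_dslope unitDisk_mem_nhds).2
    (differentiableOn_sqrtOneAdd_cube.sub_const 1)
  refine h.congr fun t _ => ?_
  by_cases ht : t = 0
  · rw [ht, dslope_same, hasDerivAt_sqrtOneAdd_cube_zero.deriv, div_zero]
  · rw [dslope_of_ne _ ht, slope_def_field]
    simp [sqrtOneAdd_zero]

/-- A primitive on the disk replaces the segment integral, so that differentiating `extremalFun`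
becomes the chain rule. -/
theorem exists_extremalFun_eq : ∃ F : ℂ → ℂ, F 0 = 0 ∧
    (∀ z ∈ unitDisk, HasDerivAt F ((sqrtOneAdd (z ^ 3) - 1) / z) z) ∧
      Set.EqOn extremalFun (fun z => z * Complex.exp (F z)) unitDisk := by
  obtain ⟨F, hF0, hF⟩ := differentiableOn_extremal_integrand.isExactOn_ball.with_val_at 0 0
  refine ⟨F, hF0, hF, fun z hz => ?_⟩
  rw [extremalFun, segmentIntegral_eq differentiableOn_extremal_integrand.continuousOn hF hF0 hz]

theorem extremalFun_spec : extremalFun ∈ ClassA ∧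
    ∀ z ∈ unitDisk, logDerivQuotient extremalFun z = sqrtOneAdd (z ^ 3) := by
  obtain ⟨F, hF0, hF, hE⟩ := exists_extremalFun_eq
  have hd : ∀ z ∈ unitDisk,
      HasDerivAt extremalFun (sqrtOneAdd (z ^ 3) * Complex.exp (F z)) z := by
    intro z hz
    have h1 := (hasDerivAt_id z).mul (hF z hz).cexp
    refine (h1.congr_of_eventuallyEq (hE.eventuallyEq_of_mem (isOpen_unitDisk.mem_nhds hz))).congr_deriv ?_
    by_cases h0 : z = 0
    · simp [h0, sqrtOneAdd_zero]
    · simp only [id]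
      field_simp
      ring
  refine ⟨⟨fun z hz => (hd z hz).differentiableAt.differentiableWithinAt, by simp [extremalFun],
    ?_⟩, fun z hz => ?_⟩
  · rw [(hd 0 zero_mem_unitDisk).deriv, hF0]
    simp [sqrtOneAdd_zero]
  · by_cases h0 : z = 0
    · simp [logDerivQuotient, h0, sqrtOneAdd_zero]
    · rw [logDerivQuotient, if_neg h0, (hd z hz).deriv, hE hz]
      have := Complex.exp_ne_zero (F z)
      field_simp

theorem extremalFun_mem_SLstar : extremalFun ∈ SLstar :=
  ⟨extremalFun_spec.1, differentiableOn_sqrtOneAdd_cube.congr extremalFun_spec.2,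
    differentiableOn_sqrtOneAdd, _, isSchwarz_cube, extremalFun_spec.2⟩

end Extremal

end LemniscateStarlike

theorem theorem2p1 :
    (∀ f : ℂ → ℂ, f ∈ LemniscateStarlike.SLstar →
      ‖LemniscateStarlike.hankelDet f 3 1‖ ≤ 1 / 36) ∧
    (LemniscateStarlike.extremalFun ∈ LemniscateStarlike.SLstar ∧
      LemniscateStarlike.taylorCoeff LemniscateStarlike.extremalFun 2 = 0 ∧
      LemniscateStarlike.taylorCoeff LemniscateStarlike.extremalFun 3 = 0 ∧
      LemniscateStarlike.taylorCoeff LemniscateStarlike.extremalFun 4 = 1 / 6 ∧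
      LemniscateStarlike.taylorCoeff LemniscateStarlike.extremalFun 5 = 0 ∧
      ‖LemniscateStarlike.hankelDet LemniscateStarlike.extremalFun 3 1‖ = 1 / 36) := by
  obtain ⟨hA, hq⟩ := LemniscateStarlike.extremalFun_spec
  have hH := LemniscateStarlike.hankelDet_eq hA LemniscateStarlike.isSchwarz_cube hq
  obtain ⟨h2, h3, h4, h5⟩ := LemniscateStarlike.taylorCoeff_of_logDerivQuotient_eq hA
    LemniscateStarlike.isSchwarz_cube hq
  simp only [LemniscateStarlike.taylorCoeff_pow] at hH h2 h3 h4 h5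
  refine ⟨fun f hf => LemniscateStarlike.norm_hankelDet_le hf,
    LemniscateStarlike.extremalFun_mem_SLstar, ?_, ?_, ?_, ?_, ?_⟩
  · rw [h2]; norm_num
  · rw [h3]; norm_num
  · rw [h4]; norm_num
  · rw [h5]; norm_num
  · have : LemniscateStarlike.hankelDet LemniscateStarlike.extremalFun 3 1 = -(1 / 36) := by
      norm_num at hH
      linear_combination hH / 36864
    rw [this]
    norm_num
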